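/- Let the pseudo-factorials $(\alpha_n)_{n\ge0}$ be the integers defined by $\alpha_0=1$ and $\alpha_{n+1}=(-1)^{n+1}\sum_{k=0}^{n}\binom{n}{k}\alpha_k\alpha_{n-k}$, and let $f(w)=\sum_{n\ge0}\alpha_n w^n/n!$ be their exponential generating function. The series converges for $|w|<1$ and $f$ extends to a meromorphic function on $\mathbb{C}$, again denoted by $f$. Let $\wp(z)=\wp(z;0,-4)$ be the Weierstrass function with invariants $g_2=0$ and $g_3=-4$ (it exists; it satisfies $\wp'^2=4\wp^3+4$ and $\wp(z)\sim z^{-2}$ as $z\to0$). Then the smallest positive real period $6r$ of $\wp$ is $$6r=\pi_3\,2^{-1/3}=\frac{2^{-4/3}\,3^{1/2}}{\pi}\,\Gamma\!\left(\tfrac13\right)^3,\qquad \pi_3:=3\int_0^1\frac{dy}{(1-y^3)^{2/3}},$$ and $$f(i\sqrt3\,z)=\frac{-\wp'(z+3r)-2i\sqrt3}{2i\sqrt3\,\wp(z+3r)}$$ for every $z\in\mathbb{C}$ for which $z+3r$ is neither a pole nor a zero of $\wp$. -/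

import Mathlib

/-- The pseudo-factorials: `α 0 = 1` and
`α (n+1) = (-1)^(n+1) * ∑_{k=0}^n (n choose k) * α k * α (n-k)`. -/
def pseudoFactorial : ℕ → ℤ
  | 0 => 1
  | n + 1 => (-1) ^ (n + 1) *
      ∑ k : Fin (n + 1), (n.choose k : ℤ) * pseudoFactorial k * pseudoFactorial (n - k)
  termination_by n => n
  decreasing_by
    · exact k.isLt
    · omega

/-- The recurrence, with the sum written over `{0, …, n}`. -/
theorem pseudoFactorial_succ (n : ℕ) :
    pseudoFactorial (n + 1) = (-1) ^ (n + 1) *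
      ∑ k ∈ Finset.range (n + 1),
        (n.choose k : ℤ) * pseudoFactorial k * pseudoFactorial (n - k) := by
  rw [pseudoFactorial, Finset.sum_range]

/-- `f` is the exponential generating function `∑ αₙ wⁿ / n!` of the pseudo-factorials, as a
meromorphic function on the complex plane: the series converges to `f` on the unit disc and `f` is
its meromorphic continuation (in normal form: `f` takes its correct value at every point that is
not a pole, and the value `0` at poles, so that `f` is unique). -/
def IsPseudoFactorialEGF (f : ℂ → ℂ) : Prop :=
  MeromorphicNFOn f Set.univ ∧
    ∀ w : ℂ, ‖w‖ < 1 →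
      HasSum (fun n : ℕ => (pseudoFactorial n : ℂ) * w ^ n / (n.factorial : ℂ)) (f w)

/-- The constant `π₃ = 3 ∫₀¹ (1 - y³)^(-2/3) dy`. -/
noncomputable def piThree : ℝ :=
  3 * ∫ y in (0 : ℝ)..1, 1 / (1 - y ^ 3) ^ (2 / 3 : ℝ)

/-! The recurrence says that the generating function solves `R'(w) = -R(-w)²`, `R(0) = 1`, which
fixes every Taylor coefficient at 0. Put `k = i√3` and let `a` be a half period with `℘(a) = -1`.
Since `2a` is a period, `w ↦ -w` fixes `℘(w/k + a)` and negates `℘'(w/k + a)`, so the equation for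
`(-℘' - 2k)/(2k℘)` becomes an identity in `℘` and `℘'`, a consequence of `℘'² = 4℘³ + 4`, `℘'' =
6℘²` and `k² = -3`. The identity theorem carries the equality from 0 to the plane.

The lattice with `g₂ = 0`, `g₃ = -4` is a rescaled hexagonal one. Since the invariants determine the
lattice (`lattice_eq_of_invariants`), it is stable under conjugation and under `ρ = exp(2πi/3)`. The
first makes `℘` real on the real axis and gives a least real period `T`, with `℘(T/2) = -1`. The
second shows that a real zero of `℘` lies at `T/3`. Between `T/3` and `2T/3`, `℘'` increases from
`-2` to `2`; with `u = (2 + ℘')/4` as variable, the integral `B(1/3, 1/3) = π₃` acquires a constant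
integrand, which gives `T` (`real_period_eq`). -/

open Filter Topology Set

/-! ### Identity theorem for meromorphic functions -/

section MeromorphicIdentity

/-- On the connected plane, the order of the difference is infinite either everywhere or nowhere. -/
theorem Meromorphic.eventuallyEq_nhdsNE_of_eventuallyEq {φ ψ : ℂ → ℂ} (hφ : Meromorphic φ)
    (hψ : Meromorphic ψ) {x : ℂ} (h : φ =ᶠ[𝓝[≠] x] ψ) (y : ℂ) : φ =ᶠ[𝓝[≠] y] ψ := by
  have hm : Meromorphic (φ - ψ) := fun z => (hφ z).sub (hψ z)
  have h1 : meromorphicOrderAt (φ - ψ) y = ⊤ := by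
    by_contra hne
    refine (hm.exists_meromorphicOrderAt_ne_top_iff_forall.1 ⟨y, hne⟩) x ?_
    rw [meromorphicOrderAt_eq_top_iff]
    filter_upwards [h] with z hz
    simp [hz]
  rw [meromorphicOrderAt_eq_top_iff] at h1
  filter_upwards [h1] with z hz
  simpa [sub_eq_zero] using hz

theorem AnalyticAt.eventuallyEq_of_nhdsNE {φ ψ : ℂ → ℂ} {x : ℂ} (hφ : AnalyticAt ℂ φ x)
    (hψ : AnalyticAt ℂ ψ x) (h : φ =ᶠ[𝓝[≠] x] ψ) : φ =ᶠ[𝓝 x] ψ :=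
  (hφ.meromorphicNFAt.eventuallyEq_nhdsNE_iff_eventuallyEq_nhds hψ.meromorphicNFAt).1 h

end MeromorphicIdentity

/-! ### Uniqueness for linear differential equations, by orders of vanishing -/

section LinearODE

/-- A solution of `D'' = H D` with `D x = D' x = 0` vanishes. -/
theorem AnalyticAt.eventually_eq_zero_of_deriv_deriv_eq_mul {D H : ℂ → ℂ} {x : ℂ}
    (hD : AnalyticAt ℂ D x) (hH : AnalyticAt ℂ H x) (h0 : D x = 0) (h1 : deriv D x = 0)
    (h : ∀ᶠ z in 𝓝 x, deriv (deriv D) z = H z * D z) : ∀ᶠ z in 𝓝 x, D z = 0 := by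
  rw [← analyticOrderAt_eq_top]
  by_contra hne
  have hpos : analyticOrderAt D x ≠ 0 := hD.analyticOrderAt_ne_zero.2 h0
  have hpos' : analyticOrderAt (deriv D) x ≠ 0 := hD.deriv.analyticOrderAt_ne_zero.2 h1
  obtain ⟨n, hn⟩ := ENat.ne_top_iff_exists.1 hne
  obtain ⟨k, rfl⟩ : ∃ k, n = k + 1 := Nat.exists_eq_succ_of_ne_zero (by rintro rfl; simp [← hn] at hpos)
  have h2 := analyticOrderAt_deriv_of_pos hD (n := k) (by rw [← hn]; simp)
  obtain ⟨j, rfl⟩ : ∃ j, k = j + 1 := Nat.exists_eq_succ_of_ne_zero (by rintro rfl; simp [h2] at hpos')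
  have h3 := analyticOrderAt_deriv_of_pos hD.deriv (n := j) (by rw [h2]; simp)
  have h4 : analyticOrderAt (deriv (deriv D)) x = analyticOrderAt (H * D) x :=
    analyticOrderAt_congr h
  rw [analyticOrderAt_mul hH hD, h3, ← hn] at h4
  -- Differentiating twice lowers the order by two, whereas multiplying by `H` cannot lower it.
  have h5 : ((j + 1 + 1 : ℕ) : ℕ∞) ≤ (j : ℕ∞) := h4 ▸ le_add_self
  exact absurd (Nat.cast_le.1 h5) (by omega)

/-- Uniqueness at a regular singular point: a solution of `z A D' = K D` vanishes if no natural
number `n` satisfies the indicial equation `n A(0) = K(0)`. -/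
theorem AnalyticAt.eventually_eq_zero_of_indicial {D A K : ℂ → ℂ}
    (hD : AnalyticAt ℂ D 0) (hA : ContinuousAt A 0) (hK : ContinuousAt K 0)
    (hi : ∀ n : ℕ, (n : ℂ) * A 0 ≠ K 0)
    (h : ∀ᶠ z in 𝓝[≠] 0, z * deriv D z * A z = D z * K z) : ∀ᶠ z in 𝓝 0, D z = 0 := by
  rw [← analyticOrderAt_eq_top]
  by_contra hne
  obtain ⟨n, hn⟩ := ENat.ne_top_iff_exists.1 hne
  obtain ⟨G, hG, hG0, hDG⟩ := (hD.analyticOrderAt_eq_natCast (n := n)).1 hn.symm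
  have hder : ∀ᶠ z in 𝓝 0, z * deriv D z = z ^ n * (n * G z + z * deriv G z) := by
    filter_upwards [hDG.eventually_nhds, hG.eventually_analyticAt] with z hz hGz
    have : D =ᶠ[𝓝 z] fun w => w ^ n * G w := by
      filter_upwards [hz] with w hw
      simpa using hw
    rw [this.deriv_eq]
    have hd : HasDerivAt (fun w => w ^ n * G w)
        (n * z ^ (n - 1) * G z + z ^ n * deriv G z) z :=
      (hasDerivAt_pow n z).mul hGz.differentiableAt.hasDerivAt
    rw [hd.deriv]
    rcases n with _ | n
    · simp
    · simp only [Nat.add_sub_cancel]; ring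
  -- With `D = zⁿ G` and `G(0) ≠ 0`, cancelling `zⁿ` and letting `z → 0` leaves `n A(0) = K(0)`.
  have heq : ∀ᶠ z in 𝓝[≠] 0, (n * G z + z * deriv G z) * A z = G z * K z := by
    filter_upwards [h, hder.filter_mono nhdsWithin_le_nhds, hDG.filter_mono nhdsWithin_le_nhds,
      self_mem_nhdsWithin] with z h1 h2 h3 h4
    have hz : z ^ n ≠ 0 := pow_ne_zero _ h4
    rw [h2, h3] at h1
    apply mul_left_cancel₀ hz
    simp only [sub_zero, smul_eq_mul] at h1
    linear_combination h1
  have c1 : ContinuousAt (fun z => (n * G z + z * deriv G z) * A z) 0 := by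
    have := hG.continuousAt
    have := hG.deriv.continuousAt
    fun_prop
  have c2 : ContinuousAt (fun z => G z * K z) 0 := hG.continuousAt.mul hK
  have := ((continuousAt_iff_punctured_nhds.1 c1).congr' heq)
  have := tendsto_nhds_unique this (continuousAt_iff_punctured_nhds.1 c2)
  simp only [zero_mul, add_zero] at this
  exact hi n (mul_left_cancel₀ hG0 (by linear_combination this))

end LinearODE

/-! ### The lattice as the set of poles, and its determination by the invariants -/

namespace PeriodPair

variable (L : PeriodPair)

theorem weierstrassP_congr {L M : PeriodPair} (h : L.lattice = M.lattice) :
    L.weierstrassP = M.weierstrassP := by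
  funext z
  exact (Equiv.setCongr (congrArg (fun s : Submodule ℤ ℂ => (s : Set ℂ)) h)).tsum_eq
    (fun l : M.lattice => (1 / (z - l) ^ 2 - 1 / (l : ℂ) ^ 2))

theorem mem_lattice_iff_order (z : ℂ) :
    z ∈ L.lattice ↔ meromorphicOrderAt L.weierstrassP z < 0 := by
  constructor
  · intro h
    rw [L.order_weierstrassP z h]
    decide
  · intro h
    by_contra hz
    exact absurd (L.analyticOnNhd_weierstrassP z hz).meromorphicOrderAt_nonneg (not_le.2 h)

theorem meromorphic_weierstrassP_add (a : ℂ) : Meromorphic fun z => L.weierstrassP (z + a) :=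
  fun z => (L.meromorphic_weierstrassP (z + a)).comp_analyticAt (f := L.weierstrassP) (g := fun z => z + a) (by fun_prop)

/-- The lattice is the set of poles of `℘`, so a local identity between translates, once continued
to the plane, compares the lattices. -/
theorem mem_lattice_iff_of_eventuallyEq {L M : PeriodPair} {a b x : ℂ}
    (h : (fun z => L.weierstrassP (z + a)) =ᶠ[𝓝[≠] x] fun z => M.weierstrassP (z + b)) (y : ℂ) :
    y + a ∈ L.lattice ↔ y + b ∈ M.lattice := by
  have h1 := (L.meromorphic_weierstrassP_add a).eventuallyEq_nhdsNE_of_eventuallyEq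
    (M.meromorphic_weierstrassP_add b) h y
  rw [mem_lattice_iff_order, mem_lattice_iff_order,
    ← meromorphicOrderAt_comp_add_const_eq_meromorphicOrderAt (f := L.weierstrassP),
    ← meromorphicOrderAt_comp_add_const_eq_meromorphicOrderAt (f := M.weierstrassP)]
  exact iff_of_eq (congrArg (· < 0) (meromorphicOrderAt_congr h1))

theorem periodic_weierstrassP_iff {c : ℂ} :
    Function.Periodic L.weierstrassP c ↔ c ∈ L.lattice := by
  constructor
  · intro h
    have := (mem_lattice_iff_of_eventuallyEq (L := L) (M := L) (a := c) (b := 0) (x := 0)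
      (Eventually.of_forall fun z => by simp [h z]) 0)
    simpa using this
  · exact fun h => L.periodic_weierstrassP ⟨c, h⟩

theorem weierstrassP_eq_except_zero (z : ℂ) :
    L.weierstrassP z = L.weierstrassPExcept 0 z + 1 / z ^ 2 := by
  have := L.weierstrassPExcept_add 0 z
  simp at this
  simp [← this]

theorem derivWeierstrassP_eq_except_zero (z : ℂ) :
    L.derivWeierstrassP z = L.derivWeierstrassPExcept 0 z - 2 / z ^ 3 := by
  have := L.derivWeierstrassPExcept_sub 0 z
  simp at this
  simp [← this]

theorem eventually_notMem_lattice : ∀ᶠ z in 𝓝[≠] (0 : ℂ), z ∉ L.lattice := by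
  filter_upwards [nhdsWithin_le_nhds (L.compl_lattice_sdiff_singleton_mem_nhds 0),
    self_mem_nhdsWithin] with z hz h0 hL
  exact hz ⟨hL, h0⟩

theorem deriv_weierstrassPExcept_zero :
    ∀ᶠ z in 𝓝 (0 : ℂ), deriv (L.weierstrassPExcept 0) z = L.derivWeierstrassPExcept 0 z := by
  filter_upwards [L.compl_lattice_sdiff_singleton_mem_nhds 0] with z hz
  exact L.eqOn_deriv_weierstrassPExcept_derivWeierstrassPExcept 0 hz

/-- The invariants determine the lattice. -/
theorem lattice_eq_of_invariants {L M : PeriodPair} (h2 : L.g₂ = M.g₂) (h3 : L.g₃ = M.g₃) :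
    L.lattice = M.lattice := by
  have aL := L.analyticAt_weierstrassPExcept 0
  have aM := M.analyticAt_weierstrassPExcept 0
  have bL := (L.analyticAt_derivWeierstrassPExcept 0).continuousAt
  have bM := (M.analyticAt_derivWeierstrassPExcept 0).continuousAt
  have cL := aL.continuousAt
  have cM := aM.continuousAt
  have key : ∀ᶠ z in 𝓝 0, (L.weierstrassPExcept 0 - M.weierstrassPExcept 0) z = 0 := by
    -- Subtracting the two cubic equations, with `℘ = P + 1/z²` for each lattice, makes `P_L - P_M`
    -- a factor; multiplication by `z⁴` then clears the poles.
    refine (aL.sub aM).eventually_eq_zero_of_indicial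
      (A := fun z => z ^ 3 * (L.derivWeierstrassPExcept 0 z + M.derivWeierstrassPExcept 0 z) - 4)
      (K := fun z => 4 * ((z ^ 2 * L.weierstrassPExcept 0 z + 1) ^ 2 +
        (z ^ 2 * L.weierstrassPExcept 0 z + 1) * (z ^ 2 * M.weierstrassPExcept 0 z + 1) +
        (z ^ 2 * M.weierstrassPExcept 0 z + 1) ^ 2) - M.g₂ * z ^ 4)
      (by fun_prop) (by fun_prop) ?_ ?_
    -- Here `A(0) = -4` and `K(0) = 12`, so the only exponent is `n = -3`.
    · intro n
      norm_num
      intro h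
      have : (n : ℂ) + 3 = 0 := by linear_combination -(1/4) * h
      exact absurd this (by norm_cast)
    · filter_upwards [L.eventually_notMem_lattice, M.eventually_notMem_lattice,
        L.deriv_weierstrassPExcept_zero.filter_mono nhdsWithin_le_nhds,
        M.deriv_weierstrassPExcept_zero.filter_mono nhdsWithin_le_nhds,
        aL.eventually_analyticAt.filter_mono nhdsWithin_le_nhds,
        aM.eventually_analyticAt.filter_mono nhdsWithin_le_nhds,
        self_mem_nhdsWithin] with z hL hM dL dM eL eM hz
      have hz : z ≠ 0 := hz
      rw [deriv_sub eL.differentiableAt eM.differentiableAt, dL, dM]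
      have e1 := L.derivWeierstrassP_sq z hL
      have e2 := M.derivWeierstrassP_sq z hM
      rw [weierstrassP_eq_except_zero, derivWeierstrassP_eq_except_zero] at e1 e2
      rw [h2, h3] at e1
      simp only [Pi.sub_apply]
      generalize L.weierstrassPExcept 0 z = p at *
      generalize M.weierstrassPExcept 0 z = q at *
      generalize L.derivWeierstrassPExcept 0 z = p' at *
      generalize M.derivWeierstrassPExcept 0 z = q' at *
      field_simp at e1 e2
      apply mul_left_cancel₀ (pow_ne_zero 2 hz)
      linear_combination e1 - e2
  have h : (fun z => L.weierstrassP (z + 0)) =ᶠ[𝓝[≠] 0] fun z => M.weierstrassP (z + 0) := by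
    filter_upwards [key.filter_mono nhdsWithin_le_nhds] with z hz
    rw [add_zero, weierstrassP_eq_except_zero, weierstrassP_eq_except_zero]
    rw [Pi.sub_apply, sub_eq_zero] at hz
    rw [hz]
  ext y
  simpa using mem_lattice_iff_of_eventuallyEq h y

end PeriodPair

/-! ### Homogeneity, conjugation, and existence of the lattice -/

namespace PeriodPair

/-- The image of a pair of periods under a real-linear automorphism of the plane. -/
noncomputable def mapEquiv (L : PeriodPair) (σ : ℂ ≃ₗ[ℝ] ℂ) : PeriodPair where
  ω₁ := σ L.ω₁
  ω₂ := σ L.ω₂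
  indep := by
    rw [LinearIndependent.pair_iff]
    intro s t h
    refine LinearIndependent.pair_iff.1 L.indep s t (σ.injective ?_)
    rw [map_add, map_smul, map_smul, h, map_zero]

theorem mem_lattice_mapEquiv (L : PeriodPair) (σ : ℂ ≃ₗ[ℝ] ℂ) {x : ℂ} :
    σ x ∈ (L.mapEquiv σ).lattice ↔ x ∈ L.lattice := by
  have h : ∀ m n : ℤ, σ (m * L.ω₁ + n * L.ω₂) = m * σ L.ω₁ + n * σ L.ω₂ := by
    intro m n
    rw [map_add]
    simp only [← zsmul_eq_mul]
    rw [map_zsmul, map_zsmul]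
  simp only [mem_lattice]
  refine exists_congr fun m => exists_congr fun n => ?_
  rw [← σ.injective.eq_iff (b := x), h]
  rfl

/-- The bijection between the lattices of `L` and `L.mapEquiv σ`. -/
noncomputable def latticeMapEquiv (L : PeriodPair) (σ : ℂ ≃ₗ[ℝ] ℂ) :
    L.lattice ≃ (L.mapEquiv σ).lattice :=
  σ.toEquiv.subtypeEquiv fun _ => (L.mem_lattice_mapEquiv σ).symm

@[simp]
theorem coe_latticeMapEquiv (L : PeriodPair) (σ : ℂ ≃ₗ[ℝ] ℂ) (l : L.lattice) :
    (L.latticeMapEquiv σ l : ℂ) = σ l := rfl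

/-- Multiplication by a nonzero complex number as a real-linear automorphism. -/
noncomputable def mulEquiv {c : ℂ} (hc : c ≠ 0) : ℂ ≃ₗ[ℝ] ℂ :=
  (LinearEquiv.smulOfNeZero ℂ ℂ c hc).restrictScalars ℝ

@[simp]
theorem mulEquiv_apply {c : ℂ} (hc : c ≠ 0) (z : ℂ) : mulEquiv hc z = c * z := rfl

theorem G_mapEquiv_mul (L : PeriodPair) {c : ℂ} (hc : c ≠ 0) (n : ℕ) :
    (L.mapEquiv (mulEquiv hc)).G n = (c ^ n)⁻¹ * L.G n := by
  rw [G, ← (L.latticeMapEquiv (mulEquiv hc)).tsum_eq, G, ← tsum_mul_left]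
  simp [mul_pow, mul_comm]

theorem G_mapEquiv_conj (L : PeriodPair) (n : ℕ) :
    (L.mapEquiv Complex.conjAe.toLinearEquiv).G n = (starRingEnd ℂ) (L.G n) := by
  rw [G, ← (L.latticeMapEquiv Complex.conjAe.toLinearEquiv).tsum_eq, G, Complex.conj_tsum]
  simp

theorem weierstrassP_mapEquiv_mul (L : PeriodPair) {c : ℂ} (hc : c ≠ 0) (z : ℂ) :
    (L.mapEquiv (mulEquiv hc)).weierstrassP (c * z) = (c ^ 2)⁻¹ * L.weierstrassP z := by
  rw [weierstrassP, ← (L.latticeMapEquiv (mulEquiv hc)).tsum_eq, weierstrassP, ← tsum_mul_left]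
  congr 1
  funext l
  simp only [coe_latticeMapEquiv, mulEquiv_apply, ← mul_sub, mul_pow, one_div, mul_inv]

theorem weierstrassP_mapEquiv_conj (L : PeriodPair) (z : ℂ) :
    (L.mapEquiv Complex.conjAe.toLinearEquiv).weierstrassP ((starRingEnd ℂ) z) =
      (starRingEnd ℂ) (L.weierstrassP z) := by
  rw [weierstrassP, ← (L.latticeMapEquiv Complex.conjAe.toLinearEquiv).tsum_eq, weierstrassP,
    Complex.conj_tsum]
  simp

theorem hasDerivAt_weierstrassP (L : PeriodPair) {z : ℂ} (hz : z ∉ L.lattice) :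
    HasDerivAt L.weierstrassP (L.derivWeierstrassP z) z := by
  rw [← L.deriv_weierstrassP]
  exact (L.analyticOnNhd_weierstrassP z hz).differentiableAt.hasDerivAt

theorem eventually_notMem_lattice_of_notMem (L : PeriodPair) {z : ℂ} (hz : z ∉ L.lattice) :
    ∀ᶠ w in 𝓝 z, w ∉ L.lattice :=
  L.isClosed_lattice.isOpen_compl.mem_nhds hz

theorem not_eventually_weierstrassP_eq_const (L : PeriodPair) (z c : ℂ) :
    ¬ ∀ᶠ w in 𝓝[≠] z, L.weierstrassP w = c := by
  intro h
  have h1 := L.meromorphic_weierstrassP.eventuallyEq_nhdsNE_of_eventuallyEq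
    (ψ := fun _ => c) (fun _ => analyticAt_const.meromorphicAt) h 0
  have h2 := (L.mem_lattice_iff_order 0).1 (zero_mem _)
  rw [meromorphicOrderAt_congr h1] at h2
  exact absurd analyticAt_const.meromorphicOrderAt_nonneg (not_le.2 h2)

/-- `℘'' = 6 ℘² - g₂ / 2`. -/
theorem deriv_derivWeierstrassP (L : PeriodPair) {z : ℂ} (hz : z ∉ L.lattice) :
    deriv L.derivWeierstrassP z = 6 * L.weierstrassP z ^ 2 - L.g₂ / 2 := by
  have a1 := L.analyticOnNhd_weierstrassP z hz
  have a2 := L.analyticOnNhd_derivWeierstrassP z hz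
  -- Differentiating the cubic equation gives the claim multiplied by `℘'`. That factor can be
  -- cancelled because `℘'` is not locally zero: otherwise `℘` would be locally constant.
  have hprod : ∀ᶠ w in 𝓝 z, L.derivWeierstrassP w *
      (deriv L.derivWeierstrassP w - (6 * L.weierstrassP w ^ 2 - L.g₂ / 2)) = 0 := by
    filter_upwards [(L.eventually_notMem_lattice_of_notMem hz).eventually_nhds] with w hw
    have hw' := hw.self_of_nhds
    have d1 := L.hasDerivAt_weierstrassP hw'
    have d2 := (L.analyticOnNhd_derivWeierstrassP w hw').differentiableAt.hasDerivAt
    have e : (fun u => L.derivWeierstrassP u ^ 2) =ᶠ[𝓝 w]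
        fun u => 4 * L.weierstrassP u ^ 3 - L.g₂ * L.weierstrassP u - L.g₃ :=
      hw.mono fun u hu => L.derivWeierstrassP_sq u hu
    have := e.deriv_eq
    rw [(d2.fun_pow 2).deriv,
      ((((d1.fun_pow 3).const_mul 4).fun_sub (d1.const_mul L.g₂)).sub_const L.g₃).deriv] at this
    norm_num at this
    linear_combination this / 2
  have hne : ∀ᶠ w in 𝓝[≠] z, L.derivWeierstrassP w ≠ 0 := by
    rcases a2.eventually_eq_zero_or_eventually_ne_zero with h | h
    · exfalso
      obtain ⟨ε, hε, hball⟩ := Metric.eventually_nhds_iff_ball.1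
        (h.and (L.eventually_notMem_lattice_of_notMem hz))
      refine L.not_eventually_weierstrassP_eq_const z (L.weierstrassP z)
        (nhdsWithin_le_nhds (Metric.eventually_nhds_iff_ball.2 ⟨ε, hε, fun w hw => ?_⟩))
      refine (convex_ball z ε).is_const_of_fderivWithin_eq_zero (𝕜 := ℂ)
        (fun u hu => (L.hasDerivAt_weierstrassP (hball u hu).2).differentiableAt.differentiableWithinAt)
        (fun u hu => ?_) hw (Metric.mem_ball_self hε)
      rw [fderivWithin_of_isOpen Metric.isOpen_ball hu]
      have := (L.hasDerivAt_weierstrassP (hball u hu).2)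
      rw [(hball u hu).1] at this
      rw [this.hasFDerivAt.fderiv]
      ext; simp
    · exact h
  have a3 : AnalyticAt ℂ (deriv L.derivWeierstrassP) z := a2.deriv
  have h := (a3.eventuallyEq_of_nhdsNE (ψ := fun w => 6 * L.weierstrassP w ^ 2 - L.g₂ / 2)
    (by fun_prop) (by
      filter_upwards [hne, hprod.filter_mono nhdsWithin_le_nhds] with w h1 h2
      exact sub_eq_zero.1 ((mul_eq_zero.1 h2).resolve_left h1))).self_of_nhds
  exact h

/-- Translates of `℘` with the same value and derivative differ by a period. -/
theorem sub_mem_lattice_of_eq (L : PeriodPair) {a b : ℂ} (ha : a ∉ L.lattice) (hb : b ∉ L.lattice)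
    (h : L.weierstrassP a = L.weierstrassP b)
    (h' : L.derivWeierstrassP a = L.derivWeierstrassP b) : a - b ∈ L.lattice := by
  have ha0 : 0 + a ∉ L.lattice := by simpa using ha
  have hb0 : 0 + b ∉ L.lattice := by simpa using hb
  have tr : ∀ c : ℂ, AnalyticAt ℂ (fun z : ℂ => z + c) 0 := fun c => by fun_prop
  have aa : AnalyticAt ℂ (fun z => L.weierstrassP (z + a)) 0 :=
    AnalyticAt.fun_comp_of_eq (L.analyticOnNhd_weierstrassP _ ha0) (tr a) rfl
  have ab : AnalyticAt ℂ (fun z => L.weierstrassP (z + b)) 0 :=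
    AnalyticAt.fun_comp_of_eq (L.analyticOnNhd_weierstrassP _ hb0) (tr b) rfl
  have ev : ∀ {c : ℂ}, 0 + c ∉ L.lattice → ∀ᶠ z in 𝓝 (0 : ℂ), z + c ∉ L.lattice := fun {c} hc =>
    (tr c).continuousAt.eventually (L.eventually_notMem_lattice_of_notMem hc)
  have d1 : ∀ {c z : ℂ}, z + c ∉ L.lattice →
      HasDerivAt (fun z => L.weierstrassP (z + c)) (L.derivWeierstrassP (z + c)) z :=
    fun {c z} hz => (L.hasDerivAt_weierstrassP hz).comp_add_const z c
  have d2 : ∀ {c z : ℂ}, z + c ∉ L.lattice →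
      HasDerivAt (fun z => L.derivWeierstrassP (z + c))
        (6 * L.weierstrassP (z + c) ^ 2 - L.g₂ / 2) z := fun {c z} hz => by
    rw [← L.deriv_derivWeierstrassP hz]
    exact (L.analyticOnNhd_derivWeierstrassP _ hz).differentiableAt.hasDerivAt.comp_add_const z c
  have hd : ∀ᶠ z in 𝓝 0, deriv ((fun z => L.weierstrassP (z + a)) - fun z => L.weierstrassP (z + b)) z =
      L.derivWeierstrassP (z + a) - L.derivWeierstrassP (z + b) := by
    filter_upwards [ev ha0, ev hb0] with z hza hzb
    exact ((d1 hza).sub (d1 hzb)).deriv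
  -- From `℘'' = 6℘² - g₂/2`, the difference `D` of the translates satisfies `D'' = 6(℘(z+a) +
  -- ℘(z+b)) D` with zero initial data.
  have key := (aa.sub ab).eventually_eq_zero_of_deriv_deriv_eq_mul
    (H := fun z => 6 * (L.weierstrassP (z + a) + L.weierstrassP (z + b)))
    (by fun_prop) (by simp [h]) (by rw [hd.self_of_nhds]; simp [h']) (by
      filter_upwards [hd.eventually_nhds, ev ha0, ev hb0] with z hz hza hzb
      rw [EventuallyEq.deriv_eq hz, ((d2 hza).fun_sub (d2 hzb)).deriv]
      simp only [Pi.sub_apply]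
      ring)
  -- At `z = -b` the second translate has a pole, hence so does the first: `a - b` is a period.
  have := mem_lattice_iff_of_eventuallyEq (L := L) (M := L) (a := a) (b := b) (x := 0)
    (nhdsWithin_le_nhds (key.mono fun z hz => sub_eq_zero.1 hz)) (-b)
  rw [neg_add_cancel] at this
  rw [sub_eq_neg_add]
  exact this.2 (zero_mem _)

theorem derivWeierstrassP_half_period (L : PeriodPair) {l : ℂ} (hl : l ∈ L.lattice) :
    L.derivWeierstrassP (l / 2) = 0 := by
  have h := L.derivWeierstrassP_add_coe (-(l / 2)) ⟨l, hl⟩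
  rw [show -(l / 2) + l = l / 2 by ring, L.derivWeierstrassP_neg] at h
  exact CharZero.eq_neg_self_iff.1 h

/-- If `g₂` vanishes, then `g₃` does not. -/
theorem g₃_ne_zero_of_g₂_eq_zero (L : PeriodPair) (h2 : L.g₂ = 0) : L.g₃ ≠ 0 := by
  intro h3
  -- If both invariants vanished, `℘` and `℘'` would both be zero at `ω₁/2` and at `ω₂/2`, and these
  -- two points would differ by a period.
  have v : ∀ l ∈ L.lattice, l / 2 ∉ L.lattice →
      L.weierstrassP (l / 2) = 0 ∧ L.derivWeierstrassP (l / 2) = 0 := by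
    intro l hl hl2
    have h0 := L.derivWeierstrassP_half_period hl
    have := L.derivWeierstrassP_sq _ hl2
    rw [h2, h3, h0] at this
    refine ⟨?_, h0⟩
    by_contra hne
    have h4 : 4 * L.weierstrassP (l / 2) ^ 3 = 0 := by linear_combination -this
    exact hne (by simpa using h4)
  have v1 := v _ L.ω₁_mem_lattice L.ω₁_div_two_notMem_lattice
  have v2 := v _ L.ω₂_mem_lattice L.ω₂_div_two_notMem_lattice
  have := L.sub_mem_lattice_of_eq L.ω₁_div_two_notMem_lattice L.ω₂_div_two_notMem_lattice
    (v1.1.trans v2.1.symm) (v1.2.trans v2.2.symm)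
  have hq := L.mul_ω₁_add_mul_ω₂_mem_lattice (α := 1 / 2) (β := -1 / 2)
  rw [show ((1 / 2 : ℚ) : ℂ) * L.ω₁ + ((-1 / 2 : ℚ) : ℂ) * L.ω₂ = L.ω₁ / 2 - L.ω₂ / 2 by
    push_cast; ring] at hq
  have h5 := (hq.1 this).1
  norm_num at h5

/-- The hexagonal lattice. -/
noncomputable def hexagonal : PeriodPair where
  ω₁ := 1
  ω₂ := Complex.exp (2 * Real.pi * Complex.I / 3)
  indep := by
    rw [LinearIndependent.pair_iff]
    intro s t h
    have him : (Complex.exp (2 * Real.pi * Complex.I / 3)).im ≠ 0 := by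
      rw [show (2 * Real.pi * Complex.I / 3 : ℂ) = ((2 * Real.pi / 3 : ℝ) : ℂ) * Complex.I by
        push_cast; ring, Complex.exp_ofReal_mul_I_im]
      exact (Real.sin_pos_of_pos_of_lt_pi (by positivity) (by linarith [Real.pi_pos])).ne'
    have h1 := congrArg Complex.im h
    have ht : t = 0 := by simpa [him] using h1
    subst ht
    simpa using h

theorem isPrimitiveRoot_exp_three : IsPrimitiveRoot (Complex.exp (2 * Real.pi * Complex.I / 3)) 3 :=
  Complex.isPrimitiveRoot_exp 3 (by norm_num)

theorem one_add_root_add_sq {ρ : ℂ} (h : IsPrimitiveRoot ρ 3) : 1 + ρ + ρ ^ 2 = 0 := by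
  have := h.geom_sum_eq_zero (by norm_num)
  simpa [Finset.sum_range_succ] using this

theorem G_congr {L M : PeriodPair} (h : L.lattice = M.lattice) (n : ℕ) : L.G n = M.G n :=
  (Equiv.setCongr (congrArg (fun s : Submodule ℤ ℂ => (s : Set ℂ)) h)).tsum_eq
    (fun l : M.lattice => ((l : ℂ) ^ n)⁻¹)

theorem hexagonal_g₂ : hexagonal.g₂ = 0 := by
  have hρ := isPrimitiveRoot_exp_three
  have hs := one_add_root_add_sq hρ
  have h3 := hρ.pow_eq_one
  have h1 := hρ.ne_one (by norm_num)
  have h0 : Complex.exp (2 * Real.pi * Complex.I / 3) ≠ 0 := Complex.exp_ne_zero _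
  -- Invariance under `ρ` gives `G₄ = ρ⁻⁴ G₄ = ρ⁻¹ G₄`, which forces `G₄ = 0`.
  have hlat : (hexagonal.mapEquiv (mulEquiv h0)).lattice = hexagonal.lattice := by
    ext x
    simp only [mem_lattice, mapEquiv, hexagonal, mulEquiv_apply]
    generalize Complex.exp (2 * Real.pi * Complex.I / 3) = ρ at *
    constructor
    · rintro ⟨m, n, rfl⟩
      refine ⟨-n, m - n, ?_⟩
      push_cast
      linear_combination (-n : ℂ) * hs
    · rintro ⟨m, n, rfl⟩
      refine ⟨n - m, -m, ?_⟩
      push_cast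
      linear_combination (-m : ℂ) * hs
  have h := G_congr hlat 4
  rw [G_mapEquiv_mul] at h
  have h4 : Complex.exp (2 * Real.pi * Complex.I / 3) ^ 4 =
    Complex.exp (2 * Real.pi * Complex.I / 3) := by rw [pow_succ, h3, one_mul]
  rw [h4, inv_mul_eq_iff_eq_mul₀ h0] at h
  have : (1 - Complex.exp (2 * Real.pi * Complex.I / 3)) * hexagonal.G 4 = 0 := by
    linear_combination h
  rcases mul_eq_zero.1 this with h | h
  · exact absurd (sub_eq_zero.1 h).symm h1
  · rw [g₂, h, mul_zero]

/-- A lattice with invariants `0` and `g` exists for every `g ≠ 0`. -/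
theorem exists_g₂_eq_zero_g₃_eq {g : ℂ} (hg : g ≠ 0) : ∃ L : PeriodPair, L.g₂ = 0 ∧ L.g₃ = g := by
  have h3 := hexagonal.g₃_ne_zero_of_g₂_eq_zero hexagonal_g₂
  -- Scaling the lattice by `c` divides `g₃` by `c⁶` and keeps `g₂ = 0`.
  obtain ⟨c, hc⟩ := IsAlgClosed.exists_pow_nat_eq (hexagonal.g₃ / g) (n := 6) (by norm_num)
  have hc0 : c ≠ 0 := by
    rintro rfl
    rw [zero_pow (by norm_num)] at hc
    exact div_ne_zero h3 hg hc.symm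
  refine ⟨hexagonal.mapEquiv (mulEquiv hc0), ?_, ?_⟩
  · have := hexagonal_g₂
    rw [g₂] at this ⊢
    rw [G_mapEquiv_mul]
    linear_combination (c ^ 4)⁻¹ * this
  · have h := h3
    rw [g₃, G_mapEquiv_mul, hc]
    rw [g₃] at h ⊢
    have hG : hexagonal.G 6 ≠ 0 := right_ne_zero_of_mul h
    field_simp

end PeriodPair

/-! ### The constant `π₃` as a beta integral and as a Gamma value -/

section PiThree

/-- The substitution `u = y³`, on the open interval because both integrands are singular at an
endpoint. -/
theorem piThree_eq_integral_beta :
    piThree = ∫ u in Ioo (0 : ℝ) 1, u ^ (-(2 / 3) : ℝ) * (1 - u) ^ (-(2 / 3) : ℝ) := by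
  have himg : (fun y : ℝ => y ^ 3) '' Ioo 0 1 = Ioo 0 1 := by
    ext u
    constructor
    · rintro ⟨y, hy, rfl⟩
      exact ⟨pow_pos hy.1 3, pow_lt_one₀ hy.1.le hy.2 (by norm_num)⟩
    · intro hu
      refine ⟨u ^ (1 / 3 : ℝ), ⟨Real.rpow_pos_of_pos hu.1 _,
        Real.rpow_lt_one hu.1.le hu.2 (by norm_num)⟩, ?_⟩
      simp only
      rw [← Real.rpow_natCast, ← Real.rpow_mul hu.1.le]
      norm_num
  have hinj : InjOn (fun y : ℝ => y ^ 3) (Ioo 0 1) := fun a ha b hb h =>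
    (pow_left_inj₀ ha.1.le hb.1.le (by norm_num)).1 h
  have h := MeasureTheory.integral_image_eq_integral_abs_deriv_smul (measurableSet_Ioo (a := (0 : ℝ)) (b := 1))
    (fun x _ => (hasDerivAt_pow 3 x).hasDerivWithinAt) hinj
    (fun u => u ^ (-(2 / 3) : ℝ) * (1 - u) ^ (-(2 / 3) : ℝ))
  rw [himg] at h
  rw [h, piThree, intervalIntegral.integral_of_le zero_le_one,
    ← MeasureTheory.integral_Ioc_eq_integral_Ioo, ← MeasureTheory.integral_const_mul,
    MeasureTheory.integral_Ioc_eq_integral_Ioo, MeasureTheory.integral_Ioc_eq_integral_Ioo]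
  refine MeasureTheory.setIntegral_congr_fun measurableSet_Ioo fun y hy => ?_
  have hy0 : 0 < y := hy.1
  have h1 : 0 ≤ 1 - y ^ 3 := sub_nonneg.2 (pow_le_one₀ hy.1.le hy.2.le)
  have h2 : (y ^ 3) ^ (-(2 / 3) : ℝ) = (y ^ 2)⁻¹ := by
    rw [← Real.rpow_natCast, ← Real.rpow_mul hy0.le, ← Real.rpow_natCast, ← Real.rpow_neg hy0.le]
    norm_num
  simp only [smul_eq_mul]
  rw [h2, Real.rpow_neg h1, abs_of_nonneg (by positivity)]
  norm_num
  field_simp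

/-- `B(1/3, 1/3) = Γ(1/3)²/Γ(2/3)`, and the reflection formula at `1/3` eliminates `Γ(2/3)`. -/
theorem piThree_eq_Gamma :
    piThree = (3 : ℝ) ^ (1 / 2 : ℝ) / (2 * Real.pi) * Real.Gamma (1 / 3) ^ 3 := by
  have h1 : piThree = (Complex.betaIntegral (1 / 3 : ℝ) (1 / 3 : ℝ)).re := by
    rw [piThree_eq_integral_beta, Complex.betaIntegral, intervalIntegral.integral_of_le zero_le_one,
      MeasureTheory.integral_Ioc_eq_integral_Ioo]
    rw [MeasureTheory.setIntegral_congr_fun (g := fun u : ℝ =>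
      ((u ^ (-(2 / 3) : ℝ) * (1 - u) ^ (-(2 / 3) : ℝ) : ℝ) : ℂ)) measurableSet_Ioo]
    · rw [integral_complex_ofReal, Complex.ofReal_re]
    · intro u hu
      simp only
      rw [Complex.ofReal_mul, Complex.ofReal_cpow hu.1.le, Complex.ofReal_cpow (sub_nonneg.2 hu.2.le)]
      push_cast
      norm_num
  have h2 : Real.Gamma (1 / 3) * Real.Gamma (2 / 3) = 2 * Real.pi / Real.sqrt 3 := by
    have := Real.Gamma_mul_Gamma_one_sub (1 / 3)
    rw [show (1 : ℝ) - 1 / 3 = 2 / 3 by norm_num, show Real.pi * (1 / 3) = Real.pi / 3 by ring,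
      Real.sin_pi_div_three] at this
    rw [this]
    field_simp
  rw [h1, ← ProbabilityTheory.beta_eq_betaIntegralReal _ _ (by norm_num) (by norm_num),
    ProbabilityTheory.beta, show (1 / 3 + 1 / 3 : ℝ) = 2 / 3 by norm_num, ← Real.sqrt_eq_rpow]
  have g1 : 0 < Real.Gamma (1 / 3) := Real.Gamma_pos_of_pos (by norm_num)
  have g2 : 0 < Real.Gamma (2 / 3) := Real.Gamma_pos_of_pos (by norm_num)
  have := Real.pi_pos
  have h3 : 0 < Real.sqrt 3 := by positivity
  rw [eq_div_iff h3.ne'] at h2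
  field_simp
  linear_combination -h2

theorem piThree_mul_rpow :
    piThree * (2 : ℝ) ^ (-(1 / 3) : ℝ) =
      (2 : ℝ) ^ (-(4 / 3) : ℝ) * (3 : ℝ) ^ (1 / 2 : ℝ) / Real.pi * Real.Gamma (1 / 3) ^ 3 := by
  rw [piThree_eq_Gamma, show (-(4 / 3) : ℝ) = -(1 / 3) + -1 by norm_num,
    Real.rpow_add (by norm_num), Real.rpow_neg_one]
  have := Real.pi_pos
  field_simp

end PiThree

/-! ### The Weierstrass function on the real axis and its least period -/

namespace PeriodPair

theorem derivWeierstrassP_congr {L M : PeriodPair} (h : L.lattice = M.lattice) :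
    L.derivWeierstrassP = M.derivWeierstrassP := by
  rw [← L.deriv_weierstrassP, weierstrassP_congr h, M.deriv_weierstrassP]

theorem derivWeierstrassP_mapEquiv_mul (L : PeriodPair) {c : ℂ} (hc : c ≠ 0) (z : ℂ) :
    (L.mapEquiv (mulEquiv hc)).derivWeierstrassP (c * z) =
      (c ^ 3)⁻¹ * L.derivWeierstrassP z := by
  rw [derivWeierstrassP, ← (L.latticeMapEquiv (mulEquiv hc)).tsum_eq, derivWeierstrassP,
    mul_neg, ← tsum_mul_left]
  congr 2
  funext l
  simp only [coe_latticeMapEquiv, mulEquiv_apply, ← mul_sub, mul_pow, div_eq_mul_inv, mul_inv]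
  ring

theorem derivWeierstrassP_mapEquiv_conj (L : PeriodPair) (z : ℂ) :
    (L.mapEquiv Complex.conjAe.toLinearEquiv).derivWeierstrassP ((starRingEnd ℂ) z) =
      (starRingEnd ℂ) (L.derivWeierstrassP z) := by
  rw [derivWeierstrassP, ← (L.latticeMapEquiv Complex.conjAe.toLinearEquiv).tsum_eq,
    derivWeierstrassP, map_neg, Complex.conj_tsum]
  simp [Complex.conj_ofNat]

/-- The function `℘` restricted to the real axis. -/
noncomputable def realP (L : PeriodPair) (x : ℝ) : ℝ := (L.weierstrassP x).re

/-- The function `℘'` restricted to the real axis. -/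
noncomputable def realDerivP (L : PeriodPair) (x : ℝ) : ℝ := (L.derivWeierstrassP x).re

theorem hasDerivAt_realP (L : PeriodPair) {x : ℝ} (hx : (x : ℂ) ∉ L.lattice) :
    HasDerivAt L.realP (L.realDerivP x) x :=
  (L.hasDerivAt_weierstrassP hx).real_of_complex

section Real

variable {L : PeriodPair} (h2 : L.g₂ = 0) (h3 : L.g₃ = -4)

include h2 h3

/-- The invariants are real, so the conjugate lattice has the same ones. -/
theorem lattice_mapEquiv_conj : (L.mapEquiv Complex.conjAe.toLinearEquiv).lattice = L.lattice := by
  apply lattice_eq_of_invariants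
  · rw [h2, ← map_zero (starRingEnd ℂ), ← h2, g₂, g₂, G_mapEquiv_conj, map_mul, Complex.conj_ofNat]
  · rw [show L.g₃ = (starRingEnd ℂ) L.g₃ by rw [h3, map_neg, Complex.conj_ofNat], g₃, g₃,
      G_mapEquiv_conj, map_mul, Complex.conj_ofNat]

theorem ofReal_realP (x : ℝ) : (L.realP x : ℂ) = L.weierstrassP x := by
  have h := L.weierstrassP_mapEquiv_conj x
  rw [weierstrassP_congr (lattice_mapEquiv_conj h2 h3), Complex.conj_ofReal] at h
  exact Complex.conj_eq_iff_re.1 h.symm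

theorem ofReal_realDerivP (x : ℝ) : (L.realDerivP x : ℂ) = L.derivWeierstrassP x := by
  have h := L.derivWeierstrassP_mapEquiv_conj x
  rw [derivWeierstrassP_congr (lattice_mapEquiv_conj h2 h3), Complex.conj_ofReal] at h
  exact Complex.conj_eq_iff_re.1 h.symm

theorem realDerivP_sq {x : ℝ} (hx : (x : ℂ) ∉ L.lattice) :
    L.realDerivP x ^ 2 = 4 * L.realP x ^ 3 + 4 := by
  have h := L.derivWeierstrassP_sq x hx
  rw [h2, h3, ← ofReal_realP h2 h3, ← ofReal_realDerivP h2 h3] at h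
  have : ((L.realDerivP x ^ 2 : ℝ) : ℂ) = ((4 * L.realP x ^ 3 + 4 : ℝ) : ℂ) := by
    push_cast
    linear_combination h
  exact_mod_cast this

theorem hasDerivAt_realDerivP {x : ℝ} (hx : (x : ℂ) ∉ L.lattice) :
    HasDerivAt L.realDerivP (6 * L.realP x ^ 2) x := by
  have h := (L.analyticOnNhd_derivWeierstrassP x hx).differentiableAt.hasDerivAt
  rw [L.deriv_derivWeierstrassP hx, h2, ← ofReal_realP h2 h3] at h
  rw [show 6 * (L.realP x : ℂ) ^ 2 - 0 / 2 = ((6 * L.realP x ^ 2 : ℝ) : ℂ) by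
    push_cast; ring] at h
  exact h.real_of_complex

/-- The real periods form a discrete subgroup. It is nonzero: `l + conj l = 2 Re l` is a period for
every `l` in the lattice, and `ω₁`, `ω₂` cannot both be purely imaginary. -/
theorem exists_isLeast_real_period : ∃ T : ℝ, IsLeast {t : ℝ | 0 < t ∧ (t : ℂ) ∈ L.lattice} T := by
  have hconj : ∀ l ∈ L.lattice, ((2 * l.re : ℝ) : ℂ) ∈ L.lattice := by
    intro l hl
    have h1 := (L.mem_lattice_mapEquiv Complex.conjAe.toLinearEquiv).2 hl
    rw [lattice_mapEquiv_conj h2 h3] at h1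
    have h4 := add_mem hl h1
    rwa [show l + Complex.conjAe.toLinearEquiv l = ((2 * l.re : ℝ) : ℂ) from
      Complex.add_conj l] at h4
  have hne : ∃ t : ℝ, t ≠ 0 ∧ (t : ℂ) ∈ L.lattice := by
    by_contra! h
    have h1 : L.ω₁.re = 0 := by
      by_contra h0
      exact h (2 * L.ω₁.re) (by simpa using h0) (hconj _ L.ω₁_mem_lattice)
    have h2 : L.ω₂.re = 0 := by
      by_contra h0
      exact h (2 * L.ω₂.re) (by simpa using h0) (hconj _ L.ω₂_mem_lattice)
    have h3 := LinearIndependent.pair_iff.1 L.indep L.ω₂.im (-L.ω₁.im)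
      (by apply Complex.ext <;> simp [h1, h2]; ring)
    have h4 : L.ω₁ = 0 := Complex.ext h1 (neg_eq_zero.1 h3.2)
    have h5 := LinearIndependent.pair_iff.1 L.indep 1 0 (by simp [h4])
    exact one_ne_zero h5.1
  let H : AddSubgroup ℝ := L.lattice.toAddSubgroup.comap Complex.ofRealHom.toAddMonoidHom
  have hH : ∀ t : ℝ, t ∈ H ↔ (t : ℂ) ∈ L.lattice := fun t => Iff.rfl
  have hbot : H ≠ ⊥ := by
    obtain ⟨t, ht0, ht⟩ := hne
    intro hb
    have : t ∈ (⊥ : AddSubgroup ℝ) := hb ▸ (hH t).2 ht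
    exact ht0 (by simpa using this)
  obtain ⟨ε, hε, hball⟩ := Metric.mem_nhdsWithin_iff.1 L.eventually_notMem_lattice
  obtain ⟨T, hT⟩ := AddSubgroup.exists_isLeast_pos hbot hε (by
    rw [Set.disjoint_left]
    intro t ht htI
    refine hball (a := (t : ℂ)) ⟨?_, ?_⟩ ((hH t).1 ht)
    · simpa [abs_of_pos htI.1] using htI.2
    · simpa using htI.1.ne')
  refine ⟨T, ⟨hT.1.2, (hH T).1 hT.1.1⟩, fun t ht => hT.2 ⟨(hH t).2 ht.2, ht.1⟩⟩

variable {T : ℝ} (hT : IsLeast {t : ℝ | 0 < t ∧ (t : ℂ) ∈ L.lattice} T)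

include hT

omit h2 h3 in
theorem notMem_lattice_of_mem_Ioo {x : ℝ} (hx : x ∈ Ioo 0 T) : (x : ℂ) ∉ L.lattice :=
  fun h => not_lt.2 (hT.2 ⟨hx.1, h⟩) hx.2

theorem realP_half_period : L.realP (T / 2) = -1 ∧ L.realDerivP (T / 2) = 0 := by
  have hpos := hT.1.1
  have h0 : L.realDerivP (T / 2) = 0 := by
    have := L.derivWeierstrassP_half_period hT.1.2
    rw [show (T : ℂ) / 2 = ((T / 2 : ℝ) : ℂ) by push_cast; rfl] at this
    rw [realDerivP, this, Complex.zero_re]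
  refine ⟨?_, h0⟩
  have h := realDerivP_sq h2 h3 (notMem_lattice_of_mem_Ioo hT ⟨half_pos hpos, half_lt_self hpos⟩)
  rw [h0] at h
  have h4 : L.realP (T / 2) ^ 3 = (-1) ^ 3 := by linear_combination -h / 4
  exact (Odd.strictMono_pow (by decide : Odd 3)).injective h4

theorem injOn_realP : InjOn L.realP (Ioc 0 (T / 2)) := by
  intro a ha b hb hab
  have hpos := hT.1.1
  have ha' := notMem_lattice_of_mem_Ioo hT (x := a) ⟨ha.1, by linarith [ha.2]⟩
  have hb' := notMem_lattice_of_mem_Ioo hT (x := b) ⟨hb.1, by linarith [hb.2]⟩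
  have hsq : L.realDerivP a ^ 2 = L.realDerivP b ^ 2 := by
    rw [realDerivP_sq h2 h3 ha', realDerivP_sq h2 h3 hb', hab]
  have hP : L.weierstrassP a = L.weierstrassP b := by
    rw [← ofReal_realP h2 h3, ← ofReal_realP h2 h3, hab]
  have no : ∀ t : ℝ, 0 < t → (t : ℂ) ∈ L.lattice → T ≤ t := fun t h h' => hT.2 ⟨h, h'⟩
  rcases sq_eq_sq_iff_eq_or_eq_neg.1 hsq with h | h
  · have h' : L.derivWeierstrassP a = L.derivWeierstrassP b := by
      rw [← ofReal_realDerivP h2 h3, ← ofReal_realDerivP h2 h3, h]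
    have hm := L.sub_mem_lattice_of_eq ha' hb' hP h'
    have hm' := neg_mem hm
    rw [neg_sub] at hm'
    norm_cast at hm hm'
    rcases lt_trichotomy a b with hlt | heq | hlt
    · have := no _ (sub_pos.2 hlt) hm'
      linarith [ha.1, hb.2]
    · exact heq
    · have := no _ (sub_pos.2 hlt) hm
      linarith [hb.1, ha.2]
  -- Comparing `a` with `-b` makes `a + b` a period; both being at most `T/2`, they equal `T/2`.
  · have h' : L.derivWeierstrassP a = L.derivWeierstrassP (-b) := by
      rw [L.derivWeierstrassP_neg, ← ofReal_realDerivP h2 h3, ← ofReal_realDerivP h2 h3, h]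
      push_cast
      rfl
    have hm := L.sub_mem_lattice_of_eq ha' (fun hn => hb' (by simpa using neg_mem hn))
      (by rw [L.weierstrassP_neg, hP]) h'
    rw [sub_neg_eq_add] at hm
    norm_cast at hm
    have := no _ (add_pos ha.1 hb.1) hm
    linarith [ha.2, hb.2]

/-- `℘` tends to `+∞` at `0⁺` and equals `-1` at `T/2`. -/
theorem exists_realP_eq_zero : ∃ x ∈ Ioo 0 (T / 2), L.realP x = 0 := by
  have hpos := hT.1.1
  have hc : Tendsto (fun x : ℝ => (L.weierstrassPExcept 0 (x : ℂ)).re) (𝓝[>] 0) (𝓝 0) := by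
    have h := (L.analyticAt_weierstrassPExcept 0).continuousAt
    have h' : ContinuousAt (fun x : ℝ => (L.weierstrassPExcept 0 (x : ℂ)).re) 0 := by
      refine ContinuousAt.comp (f := fun x : ℝ => L.weierstrassPExcept 0 (x : ℂ))
        Complex.continuous_re.continuousAt ?_
      exact ContinuousAt.comp_of_eq (f := fun x : ℝ => (x : ℂ)) h
        Complex.continuous_ofReal.continuousAt Complex.ofReal_zero
    have := h'.tendsto.mono_left (nhdsWithin_le_nhds (s := Ioi 0))
    simpa using this
  have hi : Tendsto (fun x : ℝ => (x ^ 2)⁻¹) (𝓝[>] 0) atTop := by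
    refine tendsto_inv_nhdsGT_zero.comp (tendsto_nhdsWithin_iff.2 ⟨?_, ?_⟩)
    · have : Tendsto (fun x : ℝ => x ^ 2) (𝓝 0) (𝓝 (0 ^ 2)) := (continuous_pow 2).tendsto 0
      rw [zero_pow two_ne_zero] at this
      exact this.mono_left nhdsWithin_le_nhds
    · filter_upwards [self_mem_nhdsWithin] with x hx
      exact pow_pos (mem_Ioi.1 hx) 2
  have hlim := hc.add_atTop hi
  have heq : ∀ x : ℝ, (L.weierstrassPExcept 0 (x : ℂ)).re + (x ^ 2)⁻¹ = L.realP x := by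
    intro x
    rw [realP, L.weierstrassP_eq_except_zero, Complex.add_re, one_div]
    norm_cast
  simp only [heq] at hlim
  obtain ⟨a, ha, ha'⟩ := ((hlim.eventually_gt_atTop 0).and
    (Ioo_mem_nhdsGT (half_pos hpos))).exists
  have hcont : ContinuousOn L.realP (Icc a (T / 2)) := fun x hx =>
    (L.hasDerivAt_realP (notMem_lattice_of_mem_Ioo hT
      ⟨ha'.1.trans_le hx.1, hx.2.trans_lt (half_lt_self hpos)⟩)).continuousAt.continuousWithinAt
  obtain ⟨x, hx, hx0⟩ := intermediate_value_Icc' ha'.2.le hcont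
    (show (0 : ℝ) ∈ Icc (L.realP (T / 2)) (L.realP a) by
      rw [(realP_half_period h2 h3 hT).1]; exact ⟨by norm_num, ha.le⟩)
  refine ⟨x, ⟨ha'.1.trans_le hx.1, lt_of_le_of_ne hx.2 ?_⟩, hx0⟩
  rintro rfl
  rw [(realP_half_period h2 h3 hT).1] at hx0
  norm_num at hx0

/-- A real zero of `℘` is a third of a period. -/
theorem realP_third_period : L.realP (T / 3) = 0 := by
  obtain ⟨x, hx, hx0⟩ := exists_realP_eq_zero h2 h3 hT
  have hpos := hT.1.1
  have hρ := isPrimitiveRoot_exp_three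
  have hs := one_add_root_add_sq hρ
  have hp := hρ.pow_eq_one
  have h0 : Complex.exp (2 * Real.pi * Complex.I / 3) ≠ 0 := Complex.exp_ne_zero _
  have hxL := notMem_lattice_of_mem_Ioo hT (x := x) ⟨hx.1, by linarith [hx.2]⟩
  have hlat : (L.mapEquiv (mulEquiv h0)).lattice = L.lattice := by
    apply lattice_eq_of_invariants
    · have h : L.G 4 = 0 := by simpa [g₂] using h2
      rw [g₂, g₂, G_mapEquiv_mul, h, mul_zero]
    · simp only [g₃]
      rw [G_mapEquiv_mul, show (6 : ℕ) = 3 * 2 from rfl, pow_mul, hp]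
      simp
  have e1 := L.weierstrassP_mapEquiv_mul h0 x
  have e2 := L.derivWeierstrassP_mapEquiv_mul h0 x
  have e3 := fun z => L.mem_lattice_mapEquiv (mulEquiv h0) (x := z)
  rw [weierstrassP_congr hlat, ← ofReal_realP h2 h3, hx0, Complex.ofReal_zero, mul_zero] at e1
  rw [derivWeierstrassP_congr hlat, hp, inv_one, one_mul] at e2
  rw [hlat] at e3
  simp only [mulEquiv_apply] at e3
  generalize Complex.exp (2 * Real.pi * Complex.I / 3) = ρ at *
  -- At a zero of `℘`, homogeneity gives `℘` and `℘'` the same values at `ρx` and `x`.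
  have hm := L.sub_mem_lattice_of_eq (a := ρ * x) (b := x) (fun h => hxL ((e3 x).1 h)) hxL
    (by rw [e1, ← ofReal_realP h2 h3, hx0, Complex.ofReal_zero]) e2
  have hm3 : ((3 * x : ℝ) : ℂ) ∈ L.lattice := by
    -- `-(ρ + 2)(ρ - 1) = 3`, because `1 + ρ + ρ² = 0`.
    have h5 := sub_mem (neg_mem ((e3 _).2 hm)) (add_mem hm hm)
    convert h5 using 1
    push_cast
    linear_combination (x : ℂ) * hs
  have h3x : T ≤ 3 * x := hT.2 ⟨by linarith [hx.1], hm3⟩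
  -- Since `x < T/2`, a value `3x > T` would make `3x - T` a positive period below `T`.
  have h3x' : 3 * x = T := by
    by_contra hne
    have hlt : T < 3 * x := lt_of_le_of_ne h3x (Ne.symm hne)
    have hm4 := sub_mem hm3 hT.1.2
    rw [← Complex.ofReal_sub] at hm4
    have := hT.2 ⟨sub_pos.2 hlt, hm4⟩
    linarith [hx.2]
  rw [← h3x', mul_div_cancel_left₀ _ (by norm_num : (3 : ℝ) ≠ 0), hx0]

omit h2 h3 in
theorem realP_period_sub (x : ℝ) : L.realP (T - x) = L.realP x := by
  have := L.weierstrassP_add_coe (-x) ⟨T, hT.1.2⟩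
  rw [L.weierstrassP_neg] at this
  simp only at this
  rw [realP, realP, ← this]
  congr 2
  push_cast
  ring

omit h2 h3 in
theorem realDerivP_period_sub (x : ℝ) : L.realDerivP (T - x) = -L.realDerivP x := by
  have := L.derivWeierstrassP_add_coe (-x) ⟨T, hT.1.2⟩
  rw [L.derivWeierstrassP_neg] at this
  simp only at this
  rw [realDerivP, realDerivP, ← Complex.neg_re, ← this]
  congr 2
  push_cast
  ring

theorem realP_ne_zero {x : ℝ} (hx : x ∈ Ioo (T / 3) (2 * T / 3)) : L.realP x ≠ 0 := by
  have hpos := hT.1.1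
  have main : ∀ y ∈ Ioc (T / 3) (T / 2), L.realP y ≠ 0 := by
    intro y hy h
    have := injOn_realP h2 h3 hT (x₁ := y) (x₂ := T / 3) ⟨by linarith [hy.1], hy.2⟩
      ⟨by linarith, by linarith⟩ (h.trans (realP_third_period h2 h3 hT).symm)
    exact hy.1.ne' this
  rcases le_or_gt x (T / 2) with h | h
  · exact main x ⟨hx.1, h⟩
  · rw [← realP_period_sub hT]
    exact main _ ⟨by linarith [hx.2], by linarith⟩

/-- `℘'' = 6℘²` is positive strictly between the zeros `T/3` and `2T/3`. -/
theorem strictMonoOn_realDerivP : StrictMonoOn L.realDerivP (Icc (T / 3) (2 * T / 3)) := by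
  have hpos := hT.1.1
  have hd : ∀ x ∈ Icc (T / 3) (2 * T / 3), HasDerivAt L.realDerivP (6 * L.realP x ^ 2) x :=
    fun x hx => hasDerivAt_realDerivP h2 h3
      (notMem_lattice_of_mem_Ioo hT ⟨by linarith [hx.1], by linarith [hx.2]⟩)
  refine strictMonoOn_of_deriv_pos (convex_Icc _ _)
    (fun x hx => (hd x hx).continuousAt.continuousWithinAt) fun x hx => ?_
  rw [interior_Icc] at hx
  rw [(hd x (Ioo_subset_Icc_self hx)).deriv]
  have := realP_ne_zero h2 h3 hT hx
  positivity

theorem realDerivP_third_period :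
    L.realDerivP (T / 3) = -2 ∧ L.realDerivP (2 * T / 3) = 2 := by
  have hpos := hT.1.1
  have h := realDerivP_sq h2 h3 (x := T / 3)
    (notMem_lattice_of_mem_Ioo hT ⟨by linarith, by linarith⟩)
  rw [realP_third_period h2 h3 hT] at h
  have hm := strictMonoOn_realDerivP h2 h3 hT (a := T / 3) (b := T / 2)
    ⟨le_rfl, by linarith⟩ ⟨by linarith, by linarith⟩ (by linarith)
  rw [(realP_half_period h2 h3 hT).2] at hm
  have h1 : L.realDerivP (T / 3) = -2 := by nlinarith
  refine ⟨h1, ?_⟩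
  rw [show 2 * T / 3 = T - T / 3 by ring, realDerivP_period_sub hT, h1, neg_neg]

/-- The least positive real period of `℘`. -/
theorem real_period_eq : T = piThree * (2 : ℝ) ^ (-(1 / 3) : ℝ) := by
  have hpos := hT.1.1
  have hd : ∀ x ∈ Icc (T / 3) (2 * T / 3), HasDerivAt L.realDerivP (6 * L.realP x ^ 2) x :=
    fun x hx => hasDerivAt_realDerivP h2 h3
      (notMem_lattice_of_mem_Ioo hT ⟨by linarith [hx.1], by linarith [hx.2]⟩)
  have hmono := strictMonoOn_realDerivP h2 h3 hT
  obtain ⟨hl, hr⟩ := realDerivP_third_period h2 h3 hT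
  have hle : T / 3 ≤ 2 * T / 3 := by linarith
  have hbd : ∀ x ∈ Ioo (T / 3) (2 * T / 3), L.realDerivP x ∈ Ioo (-2) 2 := fun x hx => by
    rw [← hl, ← hr]
    exact ⟨hmono (left_mem_Icc.2 hle) (Ioo_subset_Icc_self hx) hx.1,
      hmono (Ioo_subset_Icc_self hx) (right_mem_Icc.2 hle) hx.2⟩
  have himg : (fun x => (2 + L.realDerivP x) / 4) '' Ioo (T / 3) (2 * T / 3) = Ioo 0 1 := by
    ext u
    constructor
    · rintro ⟨x, hx, rfl⟩
      have := hbd x hx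
      exact ⟨by simp only; linarith [this.1], by simp only; linarith [this.2]⟩
    · intro hu
      obtain ⟨x, hx, hxu⟩ := intermediate_value_Ioo hle
        (fun x hx => (hd x hx).continuousAt.continuousWithinAt)
        (show 4 * u - 2 ∈ Ioo (L.realDerivP (T / 3)) (L.realDerivP (2 * T / 3)) by
          rw [hl, hr]; exact ⟨by linarith [hu.1], by linarith [hu.2]⟩)
      exact ⟨x, hx, by simp only [hxu]; ring⟩
  have hinj : InjOn (fun x => (2 + L.realDerivP x) / 4) (Ioo (T / 3) (2 * T / 3)) := by
    intro a ha b hb hab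
    refine hmono.injOn (Ioo_subset_Icc_self ha) (Ioo_subset_Icc_self hb) ?_
    simp only at hab
    linarith
  have h := MeasureTheory.integral_image_eq_integral_abs_deriv_smul
    (measurableSet_Ioo (a := T / 3) (b := 2 * T / 3))
    (fun x hx => (((hd x (Ioo_subset_Icc_self hx)).const_add 2).div_const 4).hasDerivWithinAt) hinj
    (fun u => u ^ (-(2 / 3) : ℝ) * (1 - u) ^ (-(2 / 3) : ℝ))
  -- As `u(1 - u) = (4 - ℘'²)/16 = (-℘)³/4`, the beta integrand contributes `4^(2/3) ℘⁻²`, which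
  -- cancels `du/dx = 6℘²/4` up to a constant.
  rw [himg, ← piThree_eq_integral_beta, MeasureTheory.setIntegral_congr_fun
    (g := fun _ => 3 / 2 * (4 : ℝ) ^ (2 / 3 : ℝ)) measurableSet_Ioo] at h
  · rw [MeasureTheory.setIntegral_const, Real.volume_real_Ioo_of_le hle, smul_eq_mul] at h
    rw [h, show (4 : ℝ) = 2 ^ (2 : ℝ) by norm_num, ← Real.rpow_mul (by norm_num)]
    have e : (2 : ℝ) ^ (2 * (2 / 3) : ℝ) * (2 : ℝ) ^ (-(1 / 3) : ℝ) = 2 := by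
      rw [← Real.rpow_add (by norm_num)]
      norm_num
    linear_combination -T / 2 * e
  · intro x hx
    have hb := hbd x hx
    have hsq := realDerivP_sq h2 h3 (x := x)
      (notMem_lattice_of_mem_Ioo hT ⟨by linarith [hx.1], by linarith [hx.2]⟩)
    have hne := realP_ne_zero h2 h3 hT hx
    have hneg : 0 < -L.realP x := by
      by_contra hcon
      have : 0 ≤ L.realP x ^ 3 := pow_nonneg (by linarith) 3
      nlinarith [hb.1, hb.2]
    simp only [smul_eq_mul]
    rw [← Real.mul_rpow (by linarith [hb.1]) (by linarith [hb.2]),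
      show (2 + L.realDerivP x) / 4 * (1 - (2 + L.realDerivP x) / 4) = (-L.realP x) ^ 3 / 4 by
        linear_combination -hsq / 16,
      Real.div_rpow (by positivity) (by norm_num), ← Real.rpow_natCast (-L.realP x), ← Real.rpow_mul hneg.le,
      abs_of_nonneg (by positivity), Real.rpow_neg (by norm_num : (0 : ℝ) ≤ 4),
      show ((3 : ℕ) : ℝ) * -(2 / 3) = -(2 : ℕ) by norm_num, Real.rpow_neg hneg.le,
      Real.rpow_natCast]
    field_simp
    ring

end Real

end PeriodPair

/-! ### The power series of the pseudo-factorials -/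

section Series

/-- By induction each of the `n + 1` summands is at most `n!`. This yields convergence on the unit
disc. -/
theorem abs_pseudoFactorial_le (n : ℕ) : |pseudoFactorial n| ≤ n.factorial := by
  induction n using Nat.strong_induction_on with
  | _ n ih =>
    rcases n with _ | n
    · simp [pseudoFactorial]
    · rw [pseudoFactorial_succ, abs_mul, abs_pow, abs_neg, abs_one, one_pow, one_mul]
      calc |∑ k ∈ Finset.range (n + 1), (n.choose k : ℤ) * pseudoFactorial k * pseudoFactorial (n - k)|
          ≤ ∑ k ∈ Finset.range (n + 1),
            |(n.choose k : ℤ) * pseudoFactorial k * pseudoFactorial (n - k)| :=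
            Finset.abs_sum_le_sum_abs _ _
        _ ≤ ∑ _k ∈ Finset.range (n + 1), (n.factorial : ℤ) := by
            refine Finset.sum_le_sum fun k hk => ?_
            have hk' : k ≤ n := Nat.lt_succ_iff.1 (Finset.mem_range.1 hk)
            rw [abs_mul, abs_mul, Nat.abs_cast, ← Nat.choose_mul_factorial_mul_factorial hk']
            push_cast
            have h1 := ih k (by omega)
            have h2 := ih (n - k) (by omega)
            gcongr
        _ = ((n + 1).factorial : ℤ) := by
            rw [Finset.sum_const, Finset.card_range, Nat.factorial_succ]
            simp

/-- The coefficients of the exponential generating function. -/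
noncomputable def pseudoFactorialSeries : FormalMultilinearSeries ℂ ℂ ℂ :=
  .ofScalars ℂ fun n => (pseudoFactorial n : ℂ) / n.factorial

theorem pseudoFactorialSeries_apply (w : ℂ) (n : ℕ) :
    (pseudoFactorialSeries n fun _ => w) =
      (pseudoFactorial n : ℂ) * w ^ n / (n.factorial : ℂ) := by
  rw [pseudoFactorialSeries, FormalMultilinearSeries.ofScalars_apply_eq, smul_eq_mul]
  ring

theorem one_le_radius_pseudoFactorialSeries : 1 ≤ pseudoFactorialSeries.radius := by
  have h := pseudoFactorialSeries.le_radius_of_bound (r := 1) 1 fun n => by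
    rw [pseudoFactorialSeries, FormalMultilinearSeries.ofScalars_norm, norm_div,
      Complex.norm_intCast, Complex.norm_natCast, NNReal.coe_one, one_pow, mul_one]
    refine div_le_one_of_le₀ ?_ (by positivity)
    exact_mod_cast abs_pseudoFactorial_le n
  exact_mod_cast h

theorem HasFPowerSeriesOnBall.of_hasSum_pseudoFactorial {f : ℂ → ℂ}
    (h : ∀ w : ℂ, ‖w‖ < 1 →
      HasSum (fun n : ℕ => (pseudoFactorial n : ℂ) * w ^ n / (n.factorial : ℂ)) (f w)) :
    HasFPowerSeriesOnBall f pseudoFactorialSeries 0 1 where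
  r_le := one_le_radius_pseudoFactorialSeries
  r_pos := one_pos
  hasSum {y} hy := by
    simp only [pseudoFactorialSeries_apply, zero_add]
    exact h y (by simpa [← ENNReal.ofReal_one, Metric.eball_ofReal] using hy)

theorem hasFPowerSeriesOnBall_sum_pseudoFactorial :
    HasFPowerSeriesOnBall pseudoFactorialSeries.sum pseudoFactorialSeries 0 1 :=
  (pseudoFactorialSeries.hasFPowerSeriesOnBall
    (one_pos.trans_le one_le_radius_pseudoFactorialSeries)).mono one_pos
    one_le_radius_pseudoFactorialSeries

/-- The Taylor coefficients of a solution of `R'(w) = -R(-w)²`, `R(0) = 1`. -/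
theorem AnalyticAt.iteratedDeriv_eq_pseudoFactorial {R : ℂ → ℂ} (hR : AnalyticAt ℂ R 0)
    (h0 : R 0 = 1) (hd : ∀ᶠ w in 𝓝 0, deriv R w = -(R (-w) * R (-w))) (n : ℕ) :
    iteratedDeriv n R 0 = pseudoFactorial n := by
  induction n using Nat.strong_induction_on with
  | _ n ih =>
    rcases n with _ | n
    · simp [pseudoFactorial, h0]
    · have hs : iteratedDeriv n (fun w => R w * R w) 0 =
          ∑ i ∈ Finset.range (n + 1), (n.choose i : ℂ) * pseudoFactorial i * pseudoFactorial (n - i) := by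
        rw [iteratedDeriv_fun_mul hR.contDiffAt hR.contDiffAt]
        refine Finset.sum_congr rfl fun i hi => ?_
        have := Finset.mem_range.1 hi
        rw [ih i (by omega), ih (n - i) (by omega)]
      rw [iteratedDeriv_succ', EventuallyEq.iteratedDeriv_eq n hd, iteratedDeriv_fun_neg,
        iteratedDeriv_comp_neg n (fun w => R w * R w), neg_zero, hs, pseudoFactorial_succ, smul_eq_mul]
      push_cast
      ring

theorem HasFPowerSeriesAt.of_deriv_eq_neg_sq {R : ℂ → ℂ} (hR : AnalyticAt ℂ R 0)
    (h0 : R 0 = 1) (hd : ∀ᶠ w in 𝓝 0, deriv R w = -(R (-w) * R (-w))) :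
    HasFPowerSeriesAt R pseudoFactorialSeries 0 := by
  have h := hR.hasFPowerSeriesAt
  simp only [hR.iteratedDeriv_eq_pseudoFactorial h0 hd] at h
  exact h

theorem HasFPowerSeriesAt.eventuallyEq {f g : ℂ → ℂ} {p : FormalMultilinearSeries ℂ ℂ ℂ}
    (hf : HasFPowerSeriesAt f p 0) (hg : HasFPowerSeriesAt g p 0) : f =ᶠ[𝓝 0] g := by
  filter_upwards [hf.eventually_hasSum, hg.eventually_hasSum] with w h1 h2
  simpa using h1.unique h2

end Series

/-! ### The elliptic continuation of the generating function -/

namespace PeriodPair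

/-- The elliptic function continuing the generating function of the pseudo-factorials. -/
noncomputable def egfContinuation (L : PeriodPair) (a w : ℂ) : ℂ :=
  (-L.derivWeierstrassP (w / (Complex.I * (Real.sqrt 3 : ℂ)) + a) -
      2 * Complex.I * (Real.sqrt 3 : ℂ)) /
    (2 * Complex.I * (Real.sqrt 3 : ℂ) * L.weierstrassP (w / (Complex.I * (Real.sqrt 3 : ℂ)) + a))

theorem I_mul_sqrt_three_sq : (Complex.I * (Real.sqrt 3 : ℂ)) ^ 2 = -3 := by
  rw [mul_pow, Complex.I_sq, ← Complex.ofReal_pow, Real.sq_sqrt (by norm_num)]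
  norm_num

theorem I_mul_sqrt_three_ne_zero : Complex.I * (Real.sqrt 3 : ℂ) ≠ 0 := by
  intro h
  have := I_mul_sqrt_three_sq
  rw [h] at this
  norm_num at this

theorem meromorphic_egfContinuation (L : PeriodPair) (a : ℂ) :
    Meromorphic (L.egfContinuation a) := by
  intro w
  have h1 : MeromorphicAt
      (fun w => L.weierstrassP (w / (Complex.I * (Real.sqrt 3 : ℂ)) + a)) w :=
    (L.meromorphic_weierstrassP _).comp_analyticAt (f := L.weierstrassP)
      (g := fun w => w / (Complex.I * (Real.sqrt 3 : ℂ)) + a) (by fun_prop)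
  have h2 : MeromorphicAt
      (fun w => L.derivWeierstrassP (w / (Complex.I * (Real.sqrt 3 : ℂ)) + a)) w :=
    (L.meromorphic_derivWeierstrassP _).comp_analyticAt (f := L.derivWeierstrassP)
      (g := fun w => w / (Complex.I * (Real.sqrt 3 : ℂ)) + a) (by fun_prop)
  unfold egfContinuation
  fun_prop

theorem analyticAt_egfContinuation (L : PeriodPair) {a w : ℂ}
    (hL : w / (Complex.I * (Real.sqrt 3 : ℂ)) + a ∉ L.lattice)
    (h0 : L.weierstrassP (w / (Complex.I * (Real.sqrt 3 : ℂ)) + a) ≠ 0) :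
    AnalyticAt ℂ (L.egfContinuation a) w := by
  have h1 : AnalyticAt ℂ
      (fun w => L.weierstrassP (w / (Complex.I * (Real.sqrt 3 : ℂ)) + a)) w :=
    AnalyticAt.fun_comp_of_eq (L.analyticOnNhd_weierstrassP _ hL) (by fun_prop) rfl
  have h2 : AnalyticAt ℂ
      (fun w => L.derivWeierstrassP (w / (Complex.I * (Real.sqrt 3 : ℂ)) + a)) w :=
    AnalyticAt.fun_comp_of_eq (L.analyticOnNhd_derivWeierstrassP _ hL) (by fun_prop) rfl
  unfold egfContinuation
  refine AnalyticAt.fun_div (by fun_prop) (by fun_prop) ?_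
  rw [mul_assoc 2]
  exact mul_ne_zero (mul_ne_zero two_ne_zero I_mul_sqrt_three_ne_zero) h0

theorem deriv_egfContinuation {L : PeriodPair} (h2 : L.g₂ = 0) (h3 : L.g₃ = -4) {a w : ℂ}
    (ha : 2 * a ∈ L.lattice)
    (hL : w / (Complex.I * (Real.sqrt 3 : ℂ)) + a ∉ L.lattice)
    (h0 : L.weierstrassP (w / (Complex.I * (Real.sqrt 3 : ℂ)) + a) ≠ 0) :
    deriv (L.egfContinuation a) w = -(L.egfContinuation a (-w) * L.egfContinuation a (-w)) := by
  have hk := I_mul_sqrt_three_ne_zero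
  have hk2 := I_mul_sqrt_three_sq
  unfold egfContinuation
  simp only [mul_assoc 2 Complex.I]
  generalize Complex.I * (Real.sqrt 3 : ℂ) = k at *
  have hsq := L.derivWeierstrassP_sq _ hL
  have e1 := L.weierstrassP_add_coe (-(w / k + a)) ⟨2 * a, ha⟩
  have e2 := L.derivWeierstrassP_add_coe (-(w / k + a)) ⟨2 * a, ha⟩
  simp only [L.weierstrassP_neg, L.derivWeierstrassP_neg,
    show -(w / k + a) + 2 * a = -w / k + a by ring] at e1 e2
  have hin : HasDerivAt (fun w : ℂ => w / k + a) (1 / k) w :=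
    ((hasDerivAt_id w).div_const k).add_const a
  have d1 : HasDerivAt (fun w => L.weierstrassP (w / k + a)) _ w :=
    HasDerivAt.comp w (L.hasDerivAt_weierstrassP hL) hin
  have d2 : HasDerivAt (fun w => L.derivWeierstrassP (w / k + a)) _ w :=
    HasDerivAt.comp (h₂ := L.derivWeierstrassP) w (L.analyticOnNhd_derivWeierstrassP _ hL).differentiableAt.hasDerivAt hin
  have d3 := (d2.fun_neg.sub_const (2 * k)).fun_div (d1.const_mul (2 * k))
    (mul_ne_zero (mul_ne_zero two_ne_zero hk) h0)
  rw [d3.deriv, e1, e2, L.deriv_derivWeierstrassP hL, h2]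
  rw [h2, h3] at hsq
  generalize L.weierstrassP (w / k + a) = p at *
  generalize L.derivWeierstrassP (w / k + a) = q at *
  field_simp
  -- With `p = ℘` and `q = ℘'`, the numerators differ by `3q² - 12p³ + 4k² = 12 + 4k² = 0`.
  linear_combination 3 * hsq + 4 * hk2

theorem hasFPowerSeriesAt_egfContinuation {L : PeriodPair} (h2 : L.g₂ = 0) (h3 : L.g₃ = -4) {a : ℂ}
    (ha : 2 * a ∈ L.lattice) (hL : a ∉ L.lattice) (hP : L.weierstrassP a = -1) :
    HasFPowerSeriesAt (L.egfContinuation a) pseudoFactorialSeries 0 := by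
  have hk := I_mul_sqrt_three_ne_zero
  have hP' : L.derivWeierstrassP a = 0 := by
    simpa using L.derivWeierstrassP_half_period ha
  have e0 : 0 / (Complex.I * (Real.sqrt 3 : ℂ)) + a = a := by simp
  refine .of_deriv_eq_neg_sq (L.analyticAt_egfContinuation (by rwa [e0]) (by rw [e0, hP]; simp))
    ?_ ?_
  · rw [egfContinuation, e0, hP, hP', mul_assoc 2]
    field_simp
    norm_num
  · have hc : ContinuousAt (fun w : ℂ => w / (Complex.I * (Real.sqrt 3 : ℂ)) + a) 0 := by fun_prop
    have hc' : ContinuousAt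
        (fun w : ℂ => L.weierstrassP (w / (Complex.I * (Real.sqrt 3 : ℂ)) + a)) 0 :=
      ContinuousAt.comp_of_eq (g := L.weierstrassP)
        (L.analyticOnNhd_weierstrassP a hL).continuousAt hc e0
    filter_upwards [hc.eventually (L.eventually_notMem_lattice_of_notMem (by simpa using hL)),
      hc'.eventually_ne (y := 0) (by simp [hP])] with w h4 h5
    exact deriv_egfContinuation h2 h3 ha h4 h5

/-- Equal germs at 0 give equality on punctured neighbourhoods everywhere; normal form upgrades it
to equality at points where the elliptic expression is analytic. -/
theorem eq_egfContinuation {L : PeriodPair} (h2 : L.g₂ = 0) (h3 : L.g₃ = -4) {a : ℂ}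
    (ha : 2 * a ∈ L.lattice) (hL : a ∉ L.lattice) (hP : L.weierstrassP a = -1) {f : ℂ → ℂ}
    (hf : IsPseudoFactorialEGF f) {w : ℂ}
    (hw : w / (Complex.I * (Real.sqrt 3 : ℂ)) + a ∉ L.lattice)
    (h0 : L.weierstrassP (w / (Complex.I * (Real.sqrt 3 : ℂ)) + a) ≠ 0) :
    f w = L.egfContinuation a w := by
  have h := (HasFPowerSeriesOnBall.of_hasSum_pseudoFactorial hf.2).hasFPowerSeriesAt.eventuallyEq
    (hasFPowerSeriesAt_egfContinuation h2 h3 ha hL hP)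
  have h' := (meromorphicOn_univ.1 hf.1.meromorphicOn).eventuallyEq_nhdsNE_of_eventuallyEq
    (L.meromorphic_egfContinuation a) (h.filter_mono nhdsWithin_le_nhds) w
  exact (((hf.1 (mem_univ w)).eventuallyEq_nhdsNE_iff_eventuallyEq_nhds
    (L.analyticAt_egfContinuation hw h0).meromorphicNFAt).1 h').eq_of_nhds

/-- The normal form of the elliptic function works: it agrees near 0 with the sum of the series,
hence on the whole unit disc, without locating its poles. -/
theorem exists_isPseudoFactorialEGF {L : PeriodPair} (h2 : L.g₂ = 0) (h3 : L.g₃ = -4) {a : ℂ}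
    (ha : 2 * a ∈ L.lattice) (hL : a ∉ L.lattice) (hP : L.weierstrassP a = -1) :
    ∃ f, IsPseudoFactorialEGF f := by
  have hm : MeromorphicOn (L.egfContinuation a) univ :=
    meromorphicOn_univ.2 (L.meromorphic_egfContinuation a)
  have hNF := meromorphicNFOn_toMeromorphicNFOn (L.egfContinuation a) univ
  set f := toMeromorphicNFOn (L.egfContinuation a) univ with hf
  have hS := hasFPowerSeriesOnBall_sum_pseudoFactorial
  have hball : Metric.eball (0 : ℂ) 1 = Metric.ball 0 1 := by
    rw [← ENNReal.ofReal_one, Metric.eball_ofReal]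
  have hSan := hS.analyticOnNhd
  rw [hball] at hSan
  have h0 : f =ᶠ[𝓝[≠] 0] pseudoFactorialSeries.sum :=
    (hm.toMeromorphicNFOn_eq_self_on_nhdsNE (mem_univ 0)).trans
      (((hasFPowerSeriesAt_egfContinuation h2 h3 ha hL hP).eventuallyEq
        hS.hasFPowerSeriesAt).filter_mono nhdsWithin_le_nhds)
  have hsub : MeromorphicOn (f - pseudoFactorialSeries.sum) (Metric.ball 0 1) := fun w hw =>
    (hNF (mem_univ w)).meromorphicAt.sub (hSan w hw).meromorphicAt
  refine ⟨f, hNF, fun w hw => ?_⟩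
  have hw' : w ∈ Metric.ball (0 : ℂ) 1 := by simpa using hw
  have htop : meromorphicOrderAt (f - pseudoFactorialSeries.sum) w = ⊤ := by
    by_contra hne
    refine hsub.meromorphicOrderAt_ne_top_of_isPreconnected
      (convex_ball (0 : ℂ) 1).isPreconnected hw' (Metric.mem_ball_self one_pos) hne ?_
    rw [meromorphicOrderAt_eq_top_iff]
    filter_upwards [h0] with z hz
    simp [hz]
  rw [meromorphicOrderAt_eq_top_iff] at htop
  have heq : f =ᶠ[𝓝[≠] w] pseudoFactorialSeries.sum :=
    htop.mono fun z hz => sub_eq_zero.1 hz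
  have := (((hNF (mem_univ w)).eventuallyEq_nhdsNE_iff_eventuallyEq_nhds
    (hSan w hw').meromorphicNFAt).1 heq).eq_of_nhds
  rw [this]
  have hsum := hS.hasSum (y := w) (by rwa [hball])
  simpa only [pseudoFactorialSeries_apply, zero_add] using hsum

theorem half_period_properties {L : PeriodPair} (h2 : L.g₂ = 0) (h3 : L.g₃ = -4) {T : ℝ}
    (hT : IsLeast {t : ℝ | 0 < t ∧ (t : ℂ) ∈ L.lattice} T) :
    2 * ((T / 2 : ℝ) : ℂ) ∈ L.lattice ∧ ((T / 2 : ℝ) : ℂ) ∉ L.lattice ∧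
      L.weierstrassP ((T / 2 : ℝ) : ℂ) = -1 := by
  refine ⟨?_, notMem_lattice_of_mem_Ioo hT ⟨half_pos hT.1.1, half_lt_self hT.1.1⟩, ?_⟩
  · have := hT.1.2
    push_cast
    rwa [mul_div_cancel₀ _ (two_ne_zero' ℂ)]
  · rw [← ofReal_realP h2 h3, (realP_half_period h2 h3 hT).1]
    norm_num

end PeriodPair

/-! ### The theorem, with `r = T/6` -/

theorem theorem2 :
    (∃ L : PeriodPair, L.g₂ = 0 ∧ L.g₃ = -4) ∧
    (∃ f : ℂ → ℂ, IsPseudoFactorialEGF f) ∧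
    ∀ (L : PeriodPair) (f : ℂ → ℂ), L.g₂ = 0 → L.g₃ = -4 → IsPseudoFactorialEGF f →
      ∃ r : ℝ,
        IsLeast {t : ℝ | 0 < t ∧ Function.Periodic L.weierstrassP (t : ℂ)} (6 * r) ∧
        6 * r = piThree * (2 : ℝ) ^ (-(1 / 3) : ℝ) ∧
        6 * r = (2 : ℝ) ^ (-(4 / 3) : ℝ) * (3 : ℝ) ^ (1 / 2 : ℝ) / Real.pi *
          Real.Gamma (1 / 3) ^ 3 ∧
        ∀ z : ℂ, z + 3 * (r : ℂ) ∉ L.lattice → L.weierstrassP (z + 3 * (r : ℂ)) ≠ 0 →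
          f (Complex.I * (Real.sqrt 3 : ℂ) * z) =
            (-L.derivWeierstrassP (z + 3 * (r : ℂ)) - 2 * Complex.I * (Real.sqrt 3 : ℂ)) /
              (2 * Complex.I * (Real.sqrt 3 : ℂ) * L.weierstrassP (z + 3 * (r : ℂ))) := by
  have hex : ∃ L : PeriodPair, L.g₂ = 0 ∧ L.g₃ = -4 :=
    PeriodPair.exists_g₂_eq_zero_g₃_eq (by norm_num)
  refine ⟨hex, ?_, fun L f h2 h3 hf => ?_⟩
  · obtain ⟨L, h2, h3⟩ := hex
    obtain ⟨T, hT⟩ := PeriodPair.exists_isLeast_real_period h2 h3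
    obtain ⟨h4, h5, h6⟩ := PeriodPair.half_period_properties h2 h3 hT
    exact PeriodPair.exists_isPseudoFactorialEGF h2 h3 h4 h5 h6
  · obtain ⟨T, hT⟩ := PeriodPair.exists_isLeast_real_period h2 h3
    obtain ⟨h4, h5, h6⟩ := PeriodPair.half_period_properties h2 h3 hT
    have hTeq := PeriodPair.real_period_eq h2 h3 hT
    have h6r : 6 * (T / 6) = T := by ring
    have h3r : 3 * ((T / 6 : ℝ) : ℂ) = ((T / 2 : ℝ) : ℂ) := by push_cast; ring
    refine ⟨T / 6, ?_, ?_, ?_, fun z hz hz0 => ?_⟩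
    · simpa only [h6r, L.periodic_weierstrassP_iff] using hT
    · rw [h6r, hTeq]
    · rw [h6r, hTeq, piThree_mul_rpow]
    · rw [h3r] at hz hz0 ⊢
      have hzw : Complex.I * (Real.sqrt 3 : ℂ) * z / (Complex.I * (Real.sqrt 3 : ℂ)) = z :=
        mul_div_cancel_left₀ z PeriodPair.I_mul_sqrt_three_ne_zero
      rw [PeriodPair.eq_egfContinuation h2 h3 h4 h5 h6 hf (w := Complex.I * (Real.sqrt 3 : ℂ) * z)
        (by rwa [hzw]) (by rwa [hzw]), PeriodPair.egfContinuation, hzw]
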